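/- All graphs are finite, simple and non-empty. Let $G$ be a graph; write $|G|$ for its number of vertices and $d_G(u)$ for the degree of a vertex $u$. For an independent set $I$ of $G$ put $w_G(I)=\sum_{u\in I}d_G(u)$. Call a non-empty independent set $I$ *large* if $|I|\ge 1+\min_{u\in I}d_G(u)$, and call an independent set $I$ *light* if $w_G(I)\le |G|-1$. Let $\sigma^*(G)$ be the minimum of $w_G(I)$ over all large independent sets $I$ of $G$ ($\sigma^*(G)=+\infty$ if there are none), and let $\alpha^*(G)$ be the maximum of $|I|$ over all light independent sets $I$ of $G$. A graph $H$ is $2$-connected if $|H|>2$ and $H-S$ is connected for every $S\subseteq V(H)$ with $|S|<2$. A partition $\{V_1,\dots,V_r\}$ of $V(G)$ is an *almost $2$-proper partition* of $G$ if, for a suitable numbering of its parts, $G[V_1]$ is $2$-connected or isomorphic to $K_2$, and $G[V_i]$ is $2$-connected for every $i\in\{2,\dots,r\}$. If $\sigma^*(G)\ge |G|$, then $G$ has an almost $2$-proper partition $\mathcal{P}$ with $|\mathcal{P}|\le\alpha^*(G)$. -/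

import Mathlib

namespace SimpleGraph

variable {V : Type*}

/-- `G` is `k`-connected: it has more than `k` vertices, and deleting any set of fewer than `k`
vertices leaves a connected graph. -/
def IsKConnected [Finite V] (G : SimpleGraph V) (k : ℕ) : Prop :=
  k < Nat.card V ∧ ∀ S : Finset V, S.card < k → (G.induce ((S : Set V)ᶜ)).Connected

section Invariants

variable [Fintype V] (G : SimpleGraph V) [DecidableRel G.Adj]

/-- `w_G(I)`, the sum of the degrees in `G` of the vertices of `I`. -/
def degreeWeight (I : Finset V) : ℕ := ∑ u ∈ I, G.degree u

/-- `δ_G(I)`, the minimum degree in `G` of a vertex of `I` (and `+∞` if `I` is empty, so that the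
empty set is never large). -/
noncomputable def minDegreeOn (I : Finset V) : ℕ∞ := I.inf fun u => (G.degree u : ℕ∞)

/-- `I` is a large independent set: independent with `|I| ≥ δ_G(I) + 1`. -/
def IsLargeIndepSet (I : Finset V) : Prop :=
  G.IsIndepSet (I : Set V) ∧ G.minDegreeOn I + 1 ≤ (I.card : ℕ∞)

/-- `I` is a light independent set: independent with `w_G(I) ≤ |G| - 1`. -/
def IsLightIndepSet (I : Finset V) : Prop :=
  G.IsIndepSet (I : Set V) ∧ G.degreeWeight I + 1 ≤ Fintype.card V

/-- `σ*(G)`, the minimum degree sum on large independent sets; it is `+∞` if there is no large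
independent set. -/
noncomputable def sigmaStar : ℕ∞ :=
  ⨅ (I : Finset V) (_ : G.IsLargeIndepSet I), (G.degreeWeight I : ℕ∞)

/-- `α*(G)`, the light independence number: the maximum size of a light independent set. -/
noncomputable def alphaStar : ℕ := sSup {m : ℕ | ∃ I : Finset V, G.IsLightIndepSet I ∧ I.card = m}

end Invariants

/-- `P` is an almost `2`-proper partition of `G`: one part `A` induces a `2`-connected subgraph or
a copy of `K₂`, and all the other parts induce `2`-connected subgraphs. -/
def IsAlmostTwoProper [Fintype V] [DecidableEq V] (G : SimpleGraph V)
    (P : Finpartition (Finset.univ : Finset V)) : Prop :=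
  ∃ A ∈ P.parts,
    ((G.induce (A : Set V)).IsKConnected 2 ∨
      Nonempty (G.induce (A : Set V) ≃g completeGraph (Fin 2))) ∧
    ∀ B ∈ P.parts, B ≠ A → (G.induce (B : Set V)).IsKConnected 2

end SimpleGraph

/-! The theorem is proved by induction on a vertex set `W`, in a form with two relaxations. A set
`Y` of optional vertices need not be covered and may not enter a light set; extra degrees `p`
remember edges from a cut vertex to deleted optional vertices. `bonus` measures both. The claim
`hasLarge_or_hasCover` is a dichotomy: either some light set is large up to the bonus, or the
non-optional vertices are covered by disjoint pieces (2-connected graphs, at most one edge), no more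
numerous than a light set. For `W = univ`, `Y = ∅`, `p = 0` the bonus vanishes, the first
alternative contradicts the bound on `sigmaStar`, and the second is the partition.

A disconnected `W` is handled by taking unions. A connected `W` with a cut vertex has an end block
`insert x D`, with remainder `R`. The block itself serves as a piece, unless `D` alone is covered by
one piece; then `x` becomes optional in `insert x R`, and whichever piece ends up using `x` decides
between `D ∪ {x}` and the smaller piece. If neither side can be covered by one piece, light sets of
both sides are merged at the cost of one vertex (`IsSplit.exists_isLight_of_two_le`), which is
affordable because the one on `D` has at least two vertices.

At most one edge is used thanks to the last clause of `HasCover`: a cover with an edge comes with a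
light set that is one vertex short of being large, so gaining another vertex yields the first
alternative. -/

namespace SimpleGraph

open Finset

set_option linter.unusedSectionVars false

/-! ### End blocks -/

section

variable {V : Type*} [DecidableEq V] (G : SimpleGraph V)

/-- Every bipartition of `S` into two non-empty sets is crossed by an edge of `G`. -/
def IsLinked (S : Finset V) : Prop :=
  ∀ C ⊆ S, C.Nonempty → (S \ C).Nonempty → ∃ a ∈ C, ∃ b ∈ S \ C, G.Adj a b

/-- `A` induces a non-empty connected subgraph without cut vertices. -/
def IsPiece (A : Finset V) : Prop :=
  A.Nonempty ∧ G.IsLinked A ∧ ∀ v ∈ A, G.IsLinked (A.erase v)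

/-- `W` is the disjoint union of `D`, `{x}` and `R`, and `x` separates `D` from `R`. -/
structure IsSplit (W D R : Finset V) (x : V) : Prop where
  notMem_left : x ∉ D
  notMem_right : x ∉ R
  disjoint : Disjoint D R
  eq : W = insert x (D ∪ R)
  not_adj : ∀ a ∈ D, ∀ b ∈ R, ¬ G.Adj a b
  nonempty_left : D.Nonempty
  nonempty_right : R.Nonempty

variable {G}

lemma IsSplit.symm {W D R : Finset V} {x : V} (h : G.IsSplit W D R x) : G.IsSplit W R D x where
  notMem_left := h.notMem_right
  notMem_right := h.notMem_left
  disjoint := h.disjoint.symm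
  eq := by rw [h.eq, union_comm]
  not_adj := fun a ha b hb hab => h.not_adj b hb a ha hab.symm
  nonempty_left := h.nonempty_right
  nonempty_right := h.nonempty_left

lemma IsSplit.card_eq {W D R : Finset V} {x : V} (h : G.IsSplit W D R x) :
    #W = #D + #R + 1 := by
  rw [h.eq, card_insert_of_notMem (by simp [h.notMem_left, h.notMem_right]),
    card_union_of_disjoint h.disjoint]

lemma IsSplit.mem {W D R : Finset V} {x : V} (h : G.IsSplit W D R x) : x ∈ W := by
  simp [h.eq]

lemma IsSplit.subset_left {W D R : Finset V} {x : V} (h : G.IsSplit W D R x) : D ⊆ W := by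
  rw [h.eq]; exact subset_union_left.trans (subset_insert _ _)

lemma exists_isSplit_of_not_isLinked_erase {W : Finset V} {x : V} (hx : x ∈ W)
    (h : ¬ G.IsLinked (W.erase x)) : ∃ D R, G.IsSplit W D R x := by
  unfold IsLinked at h
  push Not at h
  obtain ⟨C, hC, h1, h2, h3⟩ := h
  refine ⟨C, W.erase x \ C, fun hxC => ?_, by simp, disjoint_sdiff, ?_, h3, h1, h2⟩
  · simpa using hC hxC
  · rw [union_sdiff_of_subset hC, insert_erase hx]

/-- A connected set with a cut vertex has a split whose left side is, together with the separating
vertex, an end block. -/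
theorem exists_isSplit_isPiece {W : Finset V} (hne : W.Nonempty) (hW : G.IsLinked W)
    (hp : ¬ G.IsPiece W) : ∃ x D R, G.IsSplit W D R x ∧ G.IsPiece (insert x D) := by
  have hex : ∃ k, ∃ x D R, G.IsSplit W D R x ∧ #D = k := by
    by_contra hcon
    refine hp ⟨hne, hW, fun v hv => ?_⟩
    by_contra h
    obtain ⟨D, R, hs⟩ := exists_isSplit_of_not_isLinked_erase hv h
    exact hcon ⟨_, v, D, R, hs, rfl⟩
  classical
  obtain ⟨x, D, R, hs, hk⟩ := Nat.find_spec hex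
  -- The split is chosen with the smallest left side among all splits at all cut vertices; every
  -- failure of the end block property produces a smaller one.
  have hmin : ∀ x' D' R', G.IsSplit W D' R' x' → #D ≤ #D' := fun x' D' R' h' => by
    rw [hk]; exact Nat.find_min' hex ⟨x', D', R', h', rfl⟩
  have hD : G.IsLinked D := by
    intro C hC h1 h2
    by_contra hcon
    push Not at hcon
    have hlt : #C < #D := by
      have := card_sdiff_add_card_eq_card hC
      have := h2.card_pos
      omega
    refine absurd (hmin x C (D \ C ∪ R) ⟨fun h => hs.notMem_left (hC h), ?_, ?_, ?_, ?_, h1, ?_⟩)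
      (by omega)
    · simp [hs.notMem_left, hs.notMem_right]
    · exact disjoint_union_right.2 ⟨disjoint_sdiff, hs.disjoint.mono_left hC⟩
    · rw [← union_assoc, union_sdiff_of_subset hC, hs.eq]
    · intro a ha b hb
      rcases mem_union.1 hb with hb | hb
      · exact hcon a ha b hb
      · exact hs.not_adj a (hC ha) b hb
    · exact h2.mono subset_union_left
  refine ⟨x, D, R, hs, insert_nonempty _ _, ?_, ?_⟩
  · intro C hC h1 h2
    by_contra hcon
    push Not at hcon
    -- the side of the bipartition that avoids `x`
    obtain ⟨K, hKD, hK, hKx⟩ : ∃ K ⊆ D, K.Nonempty ∧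
        ∀ a ∈ K, ∀ b ∈ insert x D \ K, ¬ G.Adj a b := by
      by_cases hx : x ∈ C
      · refine ⟨insert x D \ C, fun a ha => ?_, h2, fun a ha b hb hab => ?_⟩
        · rw [mem_sdiff, mem_insert] at ha
          rcases ha.1 with rfl | h
          · exact absurd hx ha.2
          · exact h
        · rw [Finset.sdiff_sdiff_eq_self hC] at hb
          exact hcon b hb a ha hab.symm
      · refine ⟨C, fun a ha => ?_, h1, hcon⟩
        rcases mem_insert.1 (hC ha) with rfl | h
        · exact absurd ha hx
        · exact h
    obtain ⟨a, ha, b, hb, hab⟩ := hW K (hKD.trans hs.subset_left) hK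
      ⟨x, mem_sdiff.2 ⟨hs.mem, fun h => hs.notMem_left (hKD h)⟩⟩
    rw [hs.eq, mem_sdiff, mem_insert, mem_union] at hb
    rcases hb with ⟨rfl | hb | hb, hbK⟩
    · exact hKx a ha b (by simp [hbK]) hab
    · exact hKx a ha b (by simp [hb, hbK]) hab
    · exact hs.not_adj a (hKD ha) b hb hab
  · intro v hv
    rcases mem_insert.1 hv with rfl | hvD
    · rwa [erase_insert hs.notMem_left]
    have hvx : v ≠ x := fun h => hs.notMem_left (h ▸ hvD)
    intro C hC h1 h2
    by_contra hcon
    push Not at hcon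
    obtain ⟨K, hKD, hK, hKx⟩ : ∃ K ⊆ D.erase v, K.Nonempty ∧
        ∀ a ∈ K, ∀ b ∈ (insert x D).erase v \ K, ¬ G.Adj a b := by
      by_cases hx : x ∈ C
      · refine ⟨(insert x D).erase v \ C, fun a ha => ?_, h2, fun a ha b hb hab => ?_⟩
        · simp only [mem_sdiff, mem_insert, mem_erase] at ha ⊢
          rcases ha with ⟨⟨h1, rfl | h⟩, haC⟩
          · exact absurd hx haC
          · exact ⟨h1, h⟩
        · rw [Finset.sdiff_sdiff_eq_self hC] at hb
          exact hcon b hb a ha hab.symm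
      · refine ⟨C, fun a ha => ?_, h1, hcon⟩
        have := hC ha
        simp only [mem_insert, mem_erase] at this ⊢
        rcases this with ⟨h1, rfl | h⟩
        · exact absurd ha hx
        · exact ⟨h1, h⟩
    have hKD' : K ⊆ D := hKD.trans (erase_subset _ _)
    have hvK : v ∉ K := fun h => by simpa using hKD h
    have hxK : x ∉ K := fun h => hs.notMem_left (hKD' h)
    have hlt : #K < #D := (card_le_card hKD).trans_lt (card_erase_lt_of_mem hvD)
    refine absurd (hmin v K (W.erase v \ K) ⟨hvK, by simp, disjoint_sdiff, ?_, ?_, hK,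
      ⟨x, by simp [hvx.symm, hs.mem, hxK]⟩⟩) (by omega)
    · rw [union_sdiff_of_subset, insert_erase (hs.subset_left hvD)]
      intro a ha
      exact mem_erase.2 ⟨fun h => hvK (h ▸ ha), hs.subset_left (hKD' ha)⟩
    · intro a ha b hb hab
      rw [mem_sdiff, mem_erase, hs.eq, mem_insert, mem_union] at hb
      rcases hb with ⟨⟨hbv, rfl | hb | hb⟩, hbK⟩
      · exact hKx a ha b (by simp [hbK, hbv]) hab
      · exact hKx a ha b (by simp [hbK, hbv, hb]) hab
      · exact hs.not_adj a (hKD' ha) b hb hab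

end

/-! ### Covers, light sets and the relaxed dichotomy -/

section

variable {V : Type*} [DecidableEq V] (G : SimpleGraph V)

/-- A family of disjoint pieces inside `W`, each with at least two vertices and at most one with
exactly two, which covers all of `W` outside the set `Y` of optional vertices. -/
structure IsCover (Y W : Finset V) (P : Finset (Finset V)) : Prop where
  disjoint : (P : Set (Finset V)).PairwiseDisjoint id
  piece : ∀ A ∈ P, G.IsPiece A
  two_le : ∀ A ∈ P, 2 ≤ #A
  subset : ∀ A ∈ P, A ⊆ W
  cover : ∀ v ∈ W, v ∉ Y → ∃ A ∈ P, v ∈ A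
  unique : ∀ A ∈ P, ∀ B ∈ P, #A = 2 → #B = 2 → A = B

section Load

variable [DecidableRel G.Adj]

/-- The number of neighbours of `u` in `W`. -/
def degIn (W : Finset V) (u : V) : ℕ := #(W.filter (G.Adj u))

/-- The degree of `u` in `W`, increased by `p u`. -/
def load (p : V → ℕ) (W : Finset V) (u : V) : ℕ := G.degIn W u + p u

/-- The allowance for the optional vertices of `W` and for the extra degrees in `W`. -/
def bonus (p : V → ℕ) (Y W : Finset V) : ℕ := #(Y ∩ W) + ∑ v ∈ W, p v

/-- An independent set of non-optional vertices of `W` of load less than `|W| + ∑_W p`. -/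
structure IsLight (p : V → ℕ) (Y W U : Finset V) : Prop where
  subset : U ⊆ W
  notMem : ∀ u ∈ U, u ∉ Y
  indep : ∀ u ∈ U, ∀ v ∈ U, ¬ G.Adj u v
  weight : ∑ u ∈ U, G.load p W u + 1 ≤ #W + ∑ v ∈ W, p v

/-- There is a light set which is larger than the load of one of its vertices, up to the bonus. -/
def HasLarge (p : V → ℕ) (Y W : Finset V) : Prop :=
  ∃ U, G.IsLight p Y W U ∧ ∃ u ∈ U, G.load p W u + 1 ≤ #U + bonus p Y W

/-- There is a cover by at most as many pieces as the size of some light set, which has to contain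
a vertex of small load in case one of the pieces is an edge. -/
def HasCover (p : V → ℕ) (Y W : Finset V) : Prop :=
  ∃ U P, G.IsLight p Y W U ∧ G.IsCover Y W P ∧ #P ≤ #U ∧
    ((∃ A ∈ P, #A = 2) → ∃ u ∈ U, G.load p W u ≤ #U + bonus p Y W)

end Load

variable {G} {Y W D R C C' : Finset V} {x : V} {p : V → ℕ} {P Q : Finset (Finset V)}

lemma isCover_empty (h : W ⊆ Y) : G.IsCover Y W ∅ :=
  ⟨by simp, by simp, by simp, by simp, fun v hv hY => absurd (h hv) hY, by simp⟩

lemma isCover_singleton {A : Finset V} (hA : G.IsPiece A) (h2 : 2 ≤ #A) (hAW : A ⊆ W)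
    (h : ∀ v ∈ W, v ∉ Y → v ∈ A) : G.IsCover Y W {A} :=
  ⟨by simp, by simpa using hA, by simpa using h2, by simpa using hAW, by simpa using h,
    by simp⟩

lemma IsCover.union {Y₁ Y₂ : Finset V} (hC : G.IsCover Y₁ C P) (hC' : G.IsCover Y₂ C' Q)
    (hd : Disjoint C C') (hs : C ∪ C' ⊆ W)
    (hcov : ∀ v ∈ W, v ∉ Y → (v ∈ C ∧ v ∉ Y₁) ∨ (v ∈ C' ∧ v ∉ Y₂))
    (hu : ∀ A ∈ P, ∀ B ∈ Q, #A = 2 → #B = 2 → False) : G.IsCover Y W (P ∪ Q) where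
  disjoint := by
    intro A hA B hB hAB
    simp only [coe_union, Set.mem_union, mem_coe] at hA hB
    rcases hA with hA | hA <;> rcases hB with hB | hB
    · exact hC.disjoint hA hB hAB
    · exact hd.mono (hC.subset A hA) (hC'.subset B hB)
    · exact (hd.mono (hC.subset B hB) (hC'.subset A hA)).symm
    · exact hC'.disjoint hA hB hAB
  piece := by
    intro A hA
    rcases mem_union.1 hA with h | h
    exacts [hC.piece A h, hC'.piece A h]
  two_le := by
    intro A hA
    rcases mem_union.1 hA with h | h
    exacts [hC.two_le A h, hC'.two_le A h]
  subset := by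
    intro A hA
    rcases mem_union.1 hA with h | h
    exacts [(hC.subset A h).trans (subset_union_left.trans hs),
      (hC'.subset A h).trans (subset_union_right.trans hs)]
  cover := by
    intro v hv hvY
    rcases hcov v hv hvY with ⟨h1, h2⟩ | ⟨h1, h2⟩
    · obtain ⟨A, hA, h⟩ := hC.cover v h1 h2
      exact ⟨A, mem_union_left _ hA, h⟩
    · obtain ⟨A, hA, h⟩ := hC'.cover v h1 h2
      exact ⟨A, mem_union_right _ hA, h⟩
  unique := by
    intro A hA B hB h1 h2
    rcases mem_union.1 hA with hA | hA <;> rcases mem_union.1 hB with hB | hB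
    · exact hC.unique A hA B hB h1 h2
    · exact (hu A hA B hB h1 h2).elim
    · exact (hu B hB A hA h2 h1).elim
    · exact hC'.unique A hA B hB h1 h2

section Load

variable [DecidableRel G.Adj] {U U₁ U₂ : Finset V} {u v w w' : V}

lemma degIn_mono (h : C ⊆ W) (u : V) : G.degIn C u ≤ G.degIn W u :=
  card_le_card (filter_subset_filter _ h)

lemma degIn_add_one_le (hu : u ∈ W) : G.degIn W u + 1 ≤ #W := by
  have : W.filter (G.Adj u) ⊆ W.erase u := fun a ha => by
    rw [mem_filter] at ha
    exact mem_erase.2 ⟨ha.2.ne', ha.1⟩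
  have := card_le_card this
  have := card_erase_add_one hu
  unfold degIn
  omega

lemma degIn_eq_of_subset (hCW : C ⊆ W) (h : ∀ b ∈ W, b ∉ C → ¬ G.Adj u b) :
    G.degIn W u = G.degIn C u := by
  refine le_antisymm (card_le_card fun a ha => ?_) (degIn_mono hCW u)
  rw [mem_filter] at ha ⊢
  exact ⟨by_contra fun hc => h a ha.1 hc ha.2, ha.2⟩

lemma bonus_mono (h : C ⊆ W) : bonus p Y C ≤ bonus p Y W :=
  add_le_add (card_le_card (inter_subset_inter_left h)) (sum_le_sum_of_subset h)

lemma load_add_one_le (hu : u ∈ W) : G.load p W u + 1 ≤ #W + ∑ v ∈ W, p v := by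
  have := degIn_add_one_le (G := G) hu
  have := single_le_sum (f := p) (fun _ _ => Nat.zero_le _) hu
  unfold load
  omega

lemma isLight_singleton (hu : u ∈ W) (hY : u ∉ Y) : G.IsLight p Y W {u} :=
  ⟨by simpa using hu, by simpa using hY, by simp, by simpa using load_add_one_le hu⟩

lemma isLight_empty (h : W.Nonempty) : G.IsLight p Y W ∅ :=
  ⟨by simp, by simp, by simp, by have := h.card_pos; simp; omega⟩

lemma IsLight.mono (h : G.IsLight p Y W U) (hU : U₁ ⊆ U) : G.IsLight p Y W U₁ :=
  ⟨hU.trans h.subset, fun u hu => h.notMem u (hU hu), fun u hu v hv => h.indep u (hU hu) v (hU hv),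
    (add_le_add_left (sum_le_sum_of_subset hU) 1).trans h.weight⟩

lemma IsCover.nonempty_of_notMem (h : G.IsCover Y W P) (hu : u ∈ W) (hY : u ∉ Y) :
    P.Nonempty :=
  let ⟨A, hA, _⟩ := h.cover u hu hY
  ⟨A, hA⟩

/-- The union of independent sets without edges between them. -/
lemma indep_union (h₁ : ∀ u ∈ U₁, ∀ v ∈ U₁, ¬ G.Adj u v) (h₂ : ∀ u ∈ U₂, ∀ v ∈ U₂, ¬ G.Adj u v)
    (h : ∀ u ∈ U₁, ∀ v ∈ U₂, ¬ G.Adj u v) : ∀ u ∈ U₁ ∪ U₂, ∀ v ∈ U₁ ∪ U₂, ¬ G.Adj u v := by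
  intro u hu v hv
  rcases mem_union.1 hu with hu | hu <;> rcases mem_union.1 hv with hv | hv
  · exact h₁ u hu v hv
  · exact h u hu v hv
  · exact fun hc => h v hv u hu hc.symm
  · exact h₂ u hu v hv

/-! ### Disconnected sets -/

section Disconnected

lemma IsLight.of_component (hd : Disjoint C C') (hW : W = C ∪ C')
    (h : ∀ a ∈ C, ∀ b ∈ C', ¬ G.Adj a b) (hU : G.IsLight p Y C U) :
    G.IsLight p Y W U ∧ ∀ u ∈ U, G.load p W u = G.load p C u := by
  have hl : ∀ u ∈ U, G.load p W u = G.load p C u := fun u hu => by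
    unfold load
    rw [degIn_eq_of_subset (hW ▸ subset_union_left)]
    intro b hb hbC
    rw [hW, mem_union] at hb
    exact h u (hU.subset hu) b (hb.resolve_left hbC)
  refine ⟨⟨hU.subset.trans (hW ▸ subset_union_left), hU.notMem, hU.indep, ?_⟩, hl⟩
  have := hU.weight
  have hsum : ∑ u ∈ U, G.load p W u = ∑ u ∈ U, G.load p C u := sum_congr rfl hl
  rw [hsum, hW, card_union_of_disjoint hd, sum_union hd]
  omega

lemma HasLarge.of_component (hd : Disjoint C C') (hW : W = C ∪ C')
    (h : ∀ a ∈ C, ∀ b ∈ C', ¬ G.Adj a b) (hL : G.HasLarge p Y C) : G.HasLarge p Y W := by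
  obtain ⟨U, hU, u, hu, hlarge⟩ := hL
  obtain ⟨h1, h2⟩ := hU.of_component hd hW h
  have := bonus_mono (p := p) (Y := Y) (show C ⊆ W from hW ▸ subset_union_left)
  exact ⟨U, h1, u, hu, by rw [h2 u hu]; omega⟩

/-- Loads do not change between a component and `W`, so light sets and covers simply add up. The
only danger is an edge in each cover, and that forces a large set. -/
lemma hasLarge_or_hasCover_of_disconnected (hd : Disjoint C C') (hW : W = C ∪ C')
    (h : ∀ a ∈ C, ∀ b ∈ C', ¬ G.Adj a b) (h₁ : G.HasLarge p Y C ∨ G.HasCover p Y C)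
    (h₂ : G.HasLarge p Y C' ∨ G.HasCover p Y C') : G.HasLarge p Y W ∨ G.HasCover p Y W := by
  have h' : ∀ a ∈ C', ∀ b ∈ C, ¬ G.Adj a b := fun a ha b hb hc => h b hb a ha hc.symm
  have hW' : W = C' ∪ C := by rw [hW, union_comm]
  rcases h₁ with h₁ | ⟨U₁, P₁, hU₁, hP₁, hc₁, ht₁⟩
  · exact .inl (h₁.of_component hd hW h)
  rcases h₂ with h₂ | ⟨U₂, P₂, hU₂, hP₂, hc₂, ht₂⟩
  · exact .inl (h₂.of_component hd.symm hW' h')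
  obtain ⟨g₁, l₁⟩ := hU₁.of_component hd hW h
  obtain ⟨g₂, l₂⟩ := hU₂.of_component hd.symm hW' h'
  have hdU : Disjoint U₁ U₂ := hd.mono hU₁.subset hU₂.subset
  have hU : G.IsLight p Y W (U₁ ∪ U₂) := by
    refine ⟨union_subset g₁.subset g₂.subset, fun u hu => ?_, indep_union g₁.indep g₂.indep
      fun a ha b hb => h a (hU₁.subset ha) b (hU₂.subset hb), ?_⟩
    · rcases mem_union.1 hu with hu | hu
      exacts [g₁.notMem u hu, g₂.notMem u hu]
    · have := hU₁.weight
      have := hU₂.weight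
      have s₁ : ∑ u ∈ U₁, G.load p W u = ∑ u ∈ U₁, G.load p C u := sum_congr rfl l₁
      have s₂ : ∑ u ∈ U₂, G.load p W u = ∑ u ∈ U₂, G.load p C' u := sum_congr rfl l₂
      rw [sum_union hdU, s₁, s₂, hW, card_union_of_disjoint hd, sum_union hd]
      omega
  have hcard := card_union_of_disjoint hdU
  have b₁ := bonus_mono (p := p) (Y := Y) (show C ⊆ W from hW ▸ subset_union_left)
  have b₂ := bonus_mono (p := p) (Y := Y) (show C' ⊆ W from hW ▸ subset_union_right)
  by_cases hL : G.HasLarge p Y W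
  · exact .inl hL
  -- With an edge in `P₁`, the set `U₁` is at most one vertex short of being large, so any vertex of
  -- `U₂` would complete it.
  have key₁ : (∃ A ∈ P₁, #A = 2) → #U₂ = 0 := fun hA => by
    obtain ⟨u, hu, hle⟩ := ht₁ hA
    by_contra h0
    exact hL ⟨_, hU, u, mem_union_left _ hu, by rw [l₁ u hu]; omega⟩
  have key₂ : (∃ A ∈ P₂, #A = 2) → #U₁ = 0 := fun hA => by
    obtain ⟨u, hu, hle⟩ := ht₂ hA
    by_contra h0
    exact hL ⟨_, hU, u, mem_union_right _ hu, by rw [l₂ u hu]; omega⟩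
  refine .inr ⟨U₁ ∪ U₂, P₁ ∪ P₂, hU, hP₁.union hP₂ hd hW.ge (fun v hv hvY => ?_) ?_, ?_, ?_⟩
  · rw [hW, mem_union] at hv
    exact hv.imp (⟨·, hvY⟩) (⟨·, hvY⟩)
  · intro A hA B hB hA2 hB2
    obtain ⟨u, hu, -⟩ := ht₁ ⟨A, hA, hA2⟩
    have := key₂ ⟨B, hB, hB2⟩
    exact absurd (card_pos.2 ⟨u, hu⟩) (by omega)
  · have := card_union_le P₁ P₂
    omega
  · rintro ⟨A, hA, hA2⟩
    rcases mem_union.1 hA with hA | hA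
    · obtain ⟨u, hu, hle⟩ := ht₁ ⟨A, hA, hA2⟩
      exact ⟨u, mem_union_left _ hu, by rw [l₁ u hu]; omega⟩
    · obtain ⟨u, hu, hle⟩ := ht₂ ⟨A, hA, hA2⟩
      exact ⟨u, mem_union_right _ hu, by rw [l₂ u hu]; omega⟩

end Disconnected

end Load

end

/-! ### Combining light sets across a cut vertex -/

section

variable {V : Type*} [DecidableEq V] {G : SimpleGraph V} [DecidableRel G.Adj]
  {Y W D R U U₁ U₂ : Finset V} {x u v w w' : V} {p : V → ℕ} {P Q : Finset (Finset V)}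

lemma IsSplit.degIn_le (hs : G.IsSplit W D R x) (hu : u ∈ D) :
    G.degIn W u ≤ G.degIn D u + 1 := by
  refine (card_le_card (t := insert x (D.filter (G.Adj u))) fun a ha => ?_).trans
    (card_insert_le _ _)
  rw [mem_filter, hs.eq, mem_insert, mem_union] at ha
  rw [mem_insert, mem_filter]
  rcases ha with ⟨h | h | h, h'⟩
  · exact .inl h
  · exact .inr ⟨h, h'⟩
  · exact absurd h' (hs.not_adj u hu a h)

lemma IsSplit.load_le_succ (hs : G.IsSplit W D R x) (hu : u ∈ D) :
    G.load p W u ≤ G.load p D u + 1 := by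
  have := hs.degIn_le hu
  unfold load
  omega

lemma IsSplit.load_le (hs : G.IsSplit W D R x) (hu : u ∈ D) :
    G.load p W u ≤ #D + ∑ v ∈ D, p v := by
  have := hs.load_le_succ (p := p) hu
  have := load_add_one_le (G := G) (p := p) hu
  omega

lemma IsSplit.weight_eq (hs : G.IsSplit W D R x) (p : V → ℕ) :
    #W + ∑ v ∈ W, p v = #D + #R + 1 + (∑ v ∈ D, p v) + (∑ v ∈ R, p v) + p x := by
  rw [hs.card_eq, hs.eq, sum_insert (by simp [hs.notMem_left, hs.notMem_right]),
    sum_union hs.disjoint]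
  omega

lemma IsSplit.bonus_add_le (hs : G.IsSplit W D R x) :
    bonus p Y D + bonus p Y R ≤ bonus p Y W := by
  have h1 : #(Y ∩ D) + #(Y ∩ R) ≤ #(Y ∩ W) := by
    rw [← card_union_of_disjoint (hs.disjoint.mono inter_subset_right inter_subset_right)]
    exact card_le_card (union_subset (inter_subset_inter_left hs.subset_left)
      (inter_subset_inter_left hs.symm.subset_left))
  have := hs.weight_eq p
  have := hs.card_eq
  unfold bonus
  omega

lemma IsSplit.isLight_union (hs : G.IsSplit W D R x) (hU₁ : U₁ ⊆ D) (hU₂ : U₂ ⊆ R)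
    (hY₁ : ∀ u ∈ U₁, u ∉ Y) (hY₂ : ∀ u ∈ U₂, u ∉ Y) (hi₁ : ∀ u ∈ U₁, ∀ v ∈ U₁, ¬ G.Adj u v)
    (hi₂ : ∀ u ∈ U₂, ∀ v ∈ U₂, ¬ G.Adj u v)
    (hw : ∑ u ∈ U₁, G.load p W u + ∑ u ∈ U₂, G.load p W u + 1 ≤ #W + ∑ v ∈ W, p v) :
    G.IsLight p Y W (U₁ ∪ U₂) ∧ #(U₁ ∪ U₂) = #U₁ + #U₂ := by
  have hd := hs.disjoint.mono hU₁ hU₂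
  refine ⟨⟨union_subset (hU₁.trans hs.subset_left) (hU₂.trans hs.symm.subset_left),
    fun u hu => ?_, indep_union hi₁ hi₂ fun u hu v hv => hs.not_adj u (hU₁ hu) v (hU₂ hv),
    by rwa [sum_union hd]⟩, card_union_of_disjoint hd⟩
  rcases mem_union.1 hu with hu | hu
  exacts [hY₁ u hu, hY₂ u hu]

/-- Each vertex sees at most `x` and its own side minus itself, so its load is at most the weight of
that side; the vertex `x` supplies the spare unit. -/
lemma IsSplit.isLight_pair (hs : G.IsSplit W D R x) (hu : u ∈ D) (hw : w ∈ R) (huY : u ∉ Y)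
    (hwY : w ∉ Y) : G.IsLight p Y W {u, w} ∧ #{u, w} = 2 := by
  have := hs.load_le (p := p) hu
  have := hs.symm.load_le (p := p) hw
  have := hs.weight_eq p
  simpa using hs.isLight_union (U₁ := {u}) (U₂ := {w}) (by simpa using hu) (by simpa using hw)
    (by simpa using huY) (by simpa using hwY) (by simp) (by simp)
    (by rw [sum_singleton, sum_singleton]; omega)

lemma IsSplit.sum_load_le (hs : G.IsSplit W D R x) (hU : U ⊆ D) :
    ∑ u ∈ U, G.load p W u ≤ ∑ u ∈ U, G.load p D u + #U := by
  rw [card_eq_sum_ones, ← sum_add_distrib]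
  exact sum_le_sum fun u hu => hs.load_le_succ (hU hu)

/-- Extending or modifying a light set of the left side by a vertex of a light set of the right
side that has at least two vertices. -/
lemma IsSplit.exchange (hs : G.IsSplit W D R x) (hU₁ : G.IsLight p Y D U₁)
    (hU₂ : G.IsLight p Y R U₂) (hv : v ∈ U₁) (hcard : #U₁ ≤ G.load p D v + 1)
    (h2 : 2 ≤ #U₂) :
    G.HasLarge p Y W ∨ ∃ S, G.IsLight p Y W S ∧ v ∈ S ∧ #S = #U₁ + 1 := by
  obtain ⟨w, hw, w', hw', hne⟩ := one_lt_card.1 h2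
  have hwt := hs.weight_eq p
  have hW₁ := hU₁.weight
  have hW₂ := hU₂.weight
  by_cases hle : #U₁ ≤ G.load p W w'
  -- The two loads of `w` and `w'` in `W` exceed the budget of `R` by at most one; leaving out `w'`
  -- frees enough to pay for the edges from `U₁` to `x`.
  · right
    have hpair : ∑ u ∈ {w, w'}, G.load p R u ≤ ∑ u ∈ U₂, G.load p R u :=
      sum_le_sum_of_subset (insert_subset hw (singleton_subset_iff.2 hw'))
    rw [sum_pair hne] at hpair
    have h1 := hs.symm.load_le_succ (p := p) (hU₂.subset hw)
    have h2 := hs.symm.load_le_succ (p := p) (hU₂.subset hw')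
    have h3 := hs.sum_load_le (p := p) hU₁.subset
    obtain ⟨hS, hc⟩ := hs.isLight_union (p := p) (Y := Y) (U₂ := {w}) hU₁.subset
      (by simpa using hU₂.subset hw) hU₁.notMem (by simpa using hU₂.notMem w hw) hU₁.indep
      (by simp) (by rw [sum_singleton]; omega)
    exact ⟨_, hS, mem_union_left _ hv, by simpa using hc⟩
  -- Here `w'` has load below `#U₁`, so substituting it for `v` gives a large set of the same size.
  · left
    have h1 := hs.symm.load_le (p := p) (hU₂.subset hw')
    have h3 := hs.sum_load_le (p := p) ((erase_subset v _).trans hU₁.subset)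
    have h4 := add_sum_erase U₁ (G.load p D) hv
    have h5 := card_erase_add_one hv
    obtain ⟨hS, hc⟩ := hs.isLight_union (p := p) (Y := Y) (U₁ := U₁.erase v) (U₂ := {w'})
      ((erase_subset v _).trans hU₁.subset) (by simpa using hU₂.subset hw')
      (fun u hu => hU₁.notMem u (mem_of_mem_erase hu)) (by simpa using hU₂.notMem w' hw')
      (fun u hu v hv => hU₁.indep u (mem_of_mem_erase hu) v (mem_of_mem_erase hv))
      (by simp) (by rw [sum_singleton]; omega)
    rw [card_singleton] at hc
    exact ⟨_, hS, w', by simp, by omega⟩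

/-- Passing from `D` to `W` may raise the load of the witness `v` by one because of `x`; a vertex
from `R` restores largeness. -/
lemma IsSplit.hasLarge_of_hasLarge (hs : G.IsSplit W D R x) (hL : G.HasLarge p Y D)
    (hR : G.HasLarge p Y R ∨ ∃ U, G.IsLight p Y R U ∧ 2 ≤ #U) : G.HasLarge p Y W := by
  obtain ⟨U₁, hU₁, v, hv, hlarge⟩ := hL
  have hb := hs.bonus_add_le (p := p) (Y := Y)
  have hvl := hs.load_le_succ (p := p) (hU₁.subset hv)
  obtain ⟨U₂, hU₂, h2⟩ | ⟨w, hw, hwY, hwl⟩ : (∃ U, G.IsLight p Y R U ∧ 2 ≤ #U) ∨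
      ∃ w ∈ R, w ∉ Y ∧ G.load p R w ≤ bonus p Y R := by
    rcases hR with ⟨U₂, hU₂, w, hw, hwl⟩ | h
    · by_cases h2 : 2 ≤ #U₂
      · exact .inl ⟨U₂, hU₂, h2⟩
      · exact .inr ⟨w, hU₂.subset hw, hU₂.notMem w hw, by omega⟩
    · exact .inl h
  · by_cases hsmall : G.load p D v ≤ bonus p Y D
    · obtain ⟨w, hw⟩ := card_pos.1 (by omega : 0 < #U₂)
      obtain ⟨hS, hc⟩ := hs.isLight_pair (p := p) (hU₁.subset hv) (hU₂.subset hw)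
        (hU₁.notMem v hv) (hU₂.notMem w hw)
      exact ⟨_, hS, v, by simp, by omega⟩
    -- Trimming to the least size that is still large meets the size bound of `IsSplit.exchange`.
    · obtain ⟨T, hvT, hT, hcard⟩ := exists_subsuperset_card_eq (singleton_subset_iff.2 hv)
        (n := G.load p D v + 1 - bonus p Y D) (by rw [card_singleton]; omega) (by omega)
      rw [singleton_subset_iff] at hvT
      rcases hs.exchange (hU₁.mono hT) hU₂ hvT (by omega) h2 with h | ⟨S, hS, hvS, hc⟩
      · exact h
      · exact ⟨S, hS, v, hvS, by omega⟩
  · have := hs.symm.load_le_succ (p := p) hw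
    obtain ⟨hS, hc⟩ := hs.isLight_pair (p := p) (hU₁.subset hv) hw (hU₁.notMem v hv) hwY
    exact ⟨_, hS, w, by simp, by omega⟩

/-- The union of the two light sets exceeds the weight limit by at most `#U₁ + #U₂ - 2`, since each
vertex may gain the neighbour `x`. Either every load is at least this excess and one deletion
suffices, or a vertex of small load lies in a large light subset. -/
lemma IsSplit.exists_isLight_of_two_le (hs : G.IsSplit W D R x) (hW : G.IsLinked W)
    (hU₁ : G.IsLight p Y D U₁) (hU₂ : G.IsLight p Y R U₂) (h₁ : U₁.Nonempty) :
    G.HasLarge p Y W ∨ ∃ S, G.IsLight p Y W S ∧ U₂ ⊆ S ∧ #S + 1 = #U₁ + #U₂ := by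
  have hd := hs.disjoint.mono hU₁.subset hU₂.subset
  obtain ⟨u₀, hu₀, hmin⟩ := exists_min_image (U₁ ∪ U₂) (G.load p W) (h₁.mono subset_union_left)
  have hwt := hs.weight_eq p
  have hW₁ := hU₁.weight
  have hW₂ := hU₂.weight
  have hS₁ := hs.sum_load_le (p := p) hU₁.subset
  have hS₂ := hs.symm.sum_load_le (p := p) hU₂.subset
  have hsum := sum_union (f := G.load p W) hd
  have hcard := card_union_of_disjoint hd
  have hsub : U₁ ∪ U₂ ⊆ W := union_subset (hU₁.subset.trans hs.subset_left)
    (hU₂.subset.trans hs.symm.subset_left)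
  have hlight : ∀ S ⊆ U₁ ∪ U₂, ∑ u ∈ S, G.load p W u + 1 ≤ #W + ∑ v ∈ W, p v →
      G.IsLight p Y W S := fun S hS hw => by
    have hi := indep_union hU₁.indep hU₂.indep
      fun u hu v hv => hs.not_adj u (hU₁.subset hu) v (hU₂.subset hv)
    refine ⟨hS.trans hsub, fun u hu => ?_, fun u hu v hv => hi u (hS hu) v (hS hv), hw⟩
    rcases mem_union.1 (hS hu) with h | h
    exacts [hU₁.notMem u h, hU₂.notMem u h]
  by_cases hbig : #(U₁ ∪ U₂) ≤ G.load p W u₀ + 2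
  · right
    obtain ⟨a, ha⟩ := h₁
    have ha₂ : a ∉ U₂ := Finset.disjoint_left.1 hd ha
    have haU : a ∈ U₁ ∪ U₂ := mem_union_left _ ha
    have := hmin a haU
    have := add_sum_erase _ (G.load p W) haU
    refine ⟨(U₁ ∪ U₂).erase a, hlight _ (erase_subset _ _) (by omega), fun u hu => ?_, ?_⟩
    · exact mem_erase.2 ⟨fun h => ha₂ (h ▸ hu), mem_union_right _ hu⟩
    · rw [card_erase_add_one haU, hcard]
  · left
    have hpos : 1 ≤ G.load p W u₀ := by
      have hxu : x ≠ u₀ := fun h => by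
        rcases mem_union.1 hu₀ with h' | h'
        · exact hs.notMem_left (h ▸ hU₁.subset h')
        · exact hs.notMem_right (h ▸ hU₂.subset h')
      obtain ⟨a, ha, b, hb, hab⟩ := hW {u₀} (by simpa using hsub hu₀) (by simp)
        ⟨x, by simp [hs.mem, hxu]⟩
      rw [mem_singleton] at ha
      subst ha
      have : 0 < G.degIn W a :=
        card_pos.2 ⟨b, mem_filter.2 ⟨(mem_sdiff.1 hb).1, hab⟩⟩
      unfold load
      omega
    obtain ⟨T, huT, hT, hc⟩ := exists_subsuperset_card_eq (singleton_subset_iff.2 hu₀)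
      (n := G.load p W u₀ + 1) (by simp) (by omega)
    rw [singleton_subset_iff] at huT
    refine ⟨T, hlight T hT ?_, u₀, huT, by omega⟩
    have h1 := sum_sdiff (f := G.load p W) hT
    have h2 : #((U₁ ∪ U₂) \ T) * G.load p W u₀ ≤ ∑ u ∈ (U₁ ∪ U₂) \ T, G.load p W u := by
      rw [← smul_eq_mul]
      exact card_nsmul_le_sum _ _ _ fun u hu => hmin u (mem_sdiff.1 hu).1
    have h3 := card_sdiff_add_card_eq_card hT
    generalize #((U₁ ∪ U₂) \ T) = m at *
    generalize G.load p W u₀ = d at *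
    -- This is `(m - 1) * (d - 1) ≥ 0`: the `m` deleted vertices of load at least `d` cover the
    -- excess `m + d - 1`. Connectedness gives `d ≥ 1`.
    have h4 : m + d ≤ m * d + 1 := by
      obtain ⟨m, rfl⟩ : ∃ k, m = k + 1 := ⟨m - 1, by omega⟩
      obtain ⟨d, rfl⟩ : ∃ k, d = k + 1 := ⟨d - 1, by omega⟩
      nlinarith [Nat.zero_le (m * d)]
    omega

end

/-! ### The cases of the induction at an end block -/

section

variable {V : Type*} [DecidableEq V] {G : SimpleGraph V} [DecidableRel G.Adj]
  {Y W D R U U₁ U₂ A : Finset V} {x u v w w' : V} {p : V → ℕ} {P Q : Finset (Finset V)}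

lemma IsSplit.insert_right_subset (hs : G.IsSplit W D R x) : insert x R ⊆ W :=
  insert_subset hs.mem hs.symm.subset_left

lemma IsSplit.degIn_eq_right (hs : G.IsSplit W D R x) (hu : u ∈ R) :
    G.degIn W u = G.degIn (insert x R) u := by
  refine degIn_eq_of_subset hs.insert_right_subset fun b hb hbR hub => ?_
  rw [hs.eq, mem_insert, mem_union] at hb
  rw [mem_insert, not_or] at hbR
  rcases hb with h | h | h
  exacts [hbR.1 h, hs.not_adj b h u hu hub.symm, hbR.2 h]

lemma IsSplit.degIn_eq_cut (hs : G.IsSplit W D R x) :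
    G.degIn W x = G.degIn D x + G.degIn (insert x R) x := by
  have hd : Disjoint D (insert x R) := disjoint_insert_right.2 ⟨hs.notMem_left, hs.disjoint⟩
  have hW : W = D ∪ insert x R := by rw [union_insert, hs.eq]
  unfold degIn
  rw [← card_union_of_disjoint (disjoint_filter_filter hd), ← filter_union, hW]

lemma degIn_le_card (W : Finset V) (u : V) : G.degIn W u ≤ #W := card_filter_le _ _

/-- If the left side is optional, it may be deleted in exchange for an extra degree at `x`. -/
lemma IsSplit.of_subset_optional (hs : G.IsSplit W D R x) (hD : D ⊆ Y)
    (h : G.HasLarge (Function.update p x (p x + G.degIn D x)) Y (insert x R) ∨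
      G.HasCover (Function.update p x (p x + G.degIn D x)) Y (insert x R)) :
    G.HasLarge p Y W ∨ G.HasCover p Y W := by
  set q := Function.update p x (p x + G.degIn D x) with hq
  have hqR : ∀ u ∈ R, q u = p u := fun u hu =>
    Function.update_of_ne (ne_of_mem_of_not_mem hu hs.notMem_right) _ _
  have hload : ∀ u ∈ insert x R, G.load p W u = G.load q (insert x R) u := by
    intro u hu
    unfold load
    rcases mem_insert.1 hu with rfl | hu
    · rw [hs.degIn_eq_cut, hq, Function.update_self]
      omega
    · rw [hs.degIn_eq_right hu, hqR u hu]
  have hsum : ∑ v ∈ insert x R, q v = p x + G.degIn D x + ∑ v ∈ R, p v := by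
    rw [sum_insert hs.notMem_right, hq, Function.update_self, ← hq, sum_congr rfl hqR]
  have hwt := hs.weight_eq p
  have hcW := hs.card_eq
  -- The extra degree given to `x` is at most the number of deleted optional vertices, so neither
  -- the weight limit nor the bonus grows.
  have hdD := degIn_le_card (G := G) D x
  have hlight : ∀ U, G.IsLight q Y (insert x R) U → G.IsLight p Y W U := fun U hU => by
    refine ⟨hU.subset.trans hs.insert_right_subset, hU.notMem, hU.indep, ?_⟩
    have hw := hU.weight
    have : ∑ u ∈ U, G.load p W u = ∑ u ∈ U, G.load q (insert x R) u :=
      sum_congr rfl fun u hu => hload u (hU.subset hu)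
    rw [hsum, card_insert_of_notMem hs.notMem_right] at hw
    omega
  have hbonus : bonus q Y (insert x R) ≤ bonus p Y W := by
    have : #D + #(Y ∩ insert x R) ≤ #(Y ∩ W) := by
      rw [← card_union_of_disjoint]
      · exact card_le_card (union_subset (subset_inter hD hs.subset_left)
          (inter_subset_inter_left hs.insert_right_subset))
      · exact (disjoint_insert_right.2 ⟨hs.notMem_left, hs.disjoint⟩).mono_right
          inter_subset_right
    unfold bonus
    omega
  rcases h with ⟨U, hU, u, hu, hl⟩ | ⟨U, P, hU, hP, hc, ht⟩
  · exact .inl ⟨U, hlight U hU, u, hu, by rw [hload u (hU.subset hu)]; omega⟩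
  · refine .inr ⟨U, P, hlight U hU, ⟨hP.disjoint, hP.piece, hP.two_le, fun A hA =>
      (hP.subset A hA).trans hs.insert_right_subset, fun v hv hvY => hP.cover v ?_ hvY,
      hP.unique⟩, hc, fun hA => ?_⟩
    · rw [hs.eq, mem_insert, mem_union] at hv
      rw [mem_insert]
      rcases hv with h | h | h
      exacts [.inl h, absurd (hD h) hvY, .inr h]
    · obtain ⟨u, hu, hl⟩ := ht hA
      exact ⟨u, hu, by rw [hload u (hU.subset hu)]; omega⟩

lemma IsSplit.two_le_card_insert (hs : G.IsSplit W D R x) : 2 ≤ #(insert x D) := by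
  rw [card_insert_of_notMem hs.notMem_left]
  have := hs.nonempty_left.card_pos
  omega

/-- The possible neighbour `x` is offset by `u` not being its own neighbour, so the degree is at
most `#D`. With `#A = 2` this supplies the small load required for edge pieces. -/
lemma IsSplit.load_le_of_card (hs : G.IsSplit W D R x) (hu : u ∈ D)
    (hA : ∀ v ∈ D, v ∉ Y → v ∈ A) : G.load p W u ≤ #A + bonus p Y D := by
  have h1 := hs.degIn_le hu
  have h2 := degIn_add_one_le (G := G) hu
  have h3 : #D ≤ #A + #(Y ∩ D) := by
    refine (card_le_card fun v hv => ?_).trans (card_union_le A (Y ∩ D))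
    by_cases hY : v ∈ Y
    · exact mem_union_right _ (mem_inter.2 ⟨hY, hv⟩)
    · exact mem_union_left _ (hA v hv hY)
  have := single_le_sum (f := p) (fun _ _ => Nat.zero_le _) hu
  unfold load bonus
  omega

/-- The right side is optional. -/
lemma IsSplit.hasCover_of_right_optional (hs : G.IsSplit W D R x) (hp : G.IsPiece (insert x D))
    (hu : u ∈ D) (huY : u ∉ Y) (hR : R ⊆ Y) : G.HasCover p Y W := by
  refine ⟨{u}, {insert x D}, isLight_singleton (hs.subset_left hu) huY,
    isCover_singleton hp hs.two_le_card_insert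
      (insert_subset hs.mem hs.subset_left) fun v hv hvY => ?_, by simp, ?_⟩
  · rw [hs.eq, mem_insert, mem_union] at hv
    rw [mem_insert]
    rcases hv with h | h | h
    exacts [.inl h, .inr h, absurd (hR h) hvY]
  · rintro ⟨A, hA, hA2⟩
    rw [mem_singleton] at hA
    subst hA
    rw [card_insert_of_notMem hs.notMem_left] at hA2
    have h1 := hs.load_le_of_card (Y := Y) (p := p) hu fun v hv _ => hv
    have := hs.bonus_add_le (p := p) (Y := Y)
    exact ⟨u, by simp, by rw [card_singleton]; omega⟩

/-- The left side is a single vertex. -/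
lemma IsSplit.hasLarge_of_card_eq_one (hs : G.IsSplit W D R x) (hD : #D = 1) (hu : u ∈ D)
    (huY : u ∉ Y) (hw : w ∈ R) (hwY : w ∉ Y) : G.HasLarge p Y W := by
  obtain ⟨hS, hc⟩ := hs.isLight_pair (p := p) hu hw huY hwY
  have h1 := hs.load_le_of_card (Y := Y) (p := p) hu fun v hv _ => hv
  have := hs.bonus_add_le (p := p) (Y := Y)
  exact ⟨_, hS, u, by simp, by omega⟩

lemma IsSplit.isCover_insert (hs : G.IsSplit W D R x) (hp : G.IsPiece (insert x D))
    (hD : 2 ≤ #D) (hP : G.IsCover Y R P) : G.IsCover Y W ({insert x D} ∪ P) := by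
  refine (isCover_singleton (Y := Y) hp hs.two_le_card_insert subset_rfl
    fun v hv _ => hv).union hP (disjoint_insert_left.2 ⟨hs.notMem_right, hs.disjoint⟩)
    (by rw [insert_union, ← hs.eq]) (fun v hv hvY => ?_) ?_
  · rw [hs.eq, ← insert_union, mem_union] at hv
    exact hv.imp (⟨·, hvY⟩) (⟨·, hvY⟩)
  · intro A hA B hB hA2
    rw [mem_singleton] at hA
    subst hA
    rw [card_insert_of_notMem hs.notMem_left] at hA2
    omega

lemma exists_card_eq_two_of_insert_cover (hs : G.IsSplit W D R x) (hD : 2 ≤ #D)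
    (h : ∃ A ∈ {insert x D} ∪ P, #A = 2) : ∃ A ∈ P, #A = 2 := by
  obtain ⟨A, hA, hA2⟩ := h
  rcases mem_union.1 hA with hA | hA
  · rw [mem_singleton] at hA
    subst hA
    rw [card_insert_of_notMem hs.notMem_left] at hA2
    omega
  · exact ⟨A, hA, hA2⟩

/-- The right side is covered by a single piece. -/
lemma IsSplit.hasCover_of_right_piece (hs : G.IsSplit W D R x) (hp : G.IsPiece (insert x D))
    (hD : 2 ≤ #D) (hu : u ∈ D) (huY : u ∉ Y) (hw : w ∈ R) (hwY : w ∉ Y)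
    (hA : G.IsCover Y R {A}) : G.HasCover p Y W := by
  obtain ⟨hS, hc⟩ := hs.isLight_pair (p := p) hu hw huY hwY
  refine ⟨_, _, hS, hs.isCover_insert hp hD hA, ?_, fun h => ⟨w, by simp, ?_⟩⟩
  · have := card_union_le {insert x D} {A}
    simp only [card_singleton] at this
    omega
  · obtain ⟨B, hB, hB2⟩ := exists_card_eq_two_of_insert_cover hs hD h
    rw [mem_singleton] at hB
    subst hB
    have h1 := hs.symm.load_le_of_card (Y := Y) (p := p) hw
      fun v hv hvY => by simpa using hA.cover v hv hvY
    have := hs.bonus_add_le (p := p) (Y := Y)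
    omega

/-- The left side is covered by a single piece. -/
lemma IsSplit.of_left_piece (hs : G.IsSplit W D R x) (hp : G.IsPiece (insert x D))
    (hu : u ∈ D) (huY : u ∉ Y) (hw : w ∈ R) (hwY : w ∉ Y)
    (hA : G.IsCover Y D {A})
    (h : G.HasLarge (Function.update p x 0) (insert x Y) (insert x R) ∨
      G.HasCover (Function.update p x 0) (insert x Y) (insert x R)) :
    G.HasLarge p Y W ∨ G.HasCover p Y W := by
  have hAD : A ⊆ D := hA.subset A (by simp)
  have hA2 : 2 ≤ #A := hA.two_le A (by simp)
  have hD : 2 ≤ #D := hA2.trans (card_le_card hAD)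
  have hAcov : ∀ v ∈ D, v ∉ Y → v ∈ A := fun v hv hvY => by simpa using hA.cover v hv hvY
  set q := Function.update p x 0 with hq
  have hqR : ∀ u ∈ R, q u = p u := fun u hu =>
    Function.update_of_ne (ne_of_mem_of_not_mem hu hs.notMem_right) _ _
  have hload : ∀ u ∈ R, G.load p W u = G.load q (insert x R) u := by
    intro u hu
    unfold load
    rw [hs.degIn_eq_right hu, hqR u hu]
  have hsum : ∑ v ∈ insert x R, q v = ∑ v ∈ R, p v := by
    rw [sum_insert hs.notMem_right, hq, Function.update_self, ← hq, sum_congr rfl hqR, zero_add]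
  have hwt := hs.weight_eq p
  have hcW := hs.card_eq
  have hul := hs.load_le (p := p) hu
  have hb := hs.bonus_add_le (p := p) (Y := Y)
  have hR : ∀ U, G.IsLight q (insert x Y) (insert x R) U → U ⊆ R := fun U hU a ha =>
    (mem_insert.1 (hU.subset ha)).resolve_left fun h => hU.notMem a ha (by simp [h])
  have hlight : ∀ U, G.IsLight q (insert x Y) (insert x R) U →
      G.IsLight p Y W ({u} ∪ U) ∧ #({u} ∪ U) = 1 + #U := fun U hU => by
    have hw := hU.weight
    have : ∑ u ∈ U, G.load p W u = ∑ u ∈ U, G.load q (insert x R) u :=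
      sum_congr rfl fun u hu => hload u (hR U hU hu)
    rw [hsum, card_insert_of_notMem hs.notMem_right] at hw
    simpa using hs.isLight_union (p := p) (Y := Y) (U₁ := {u}) (by simpa using hu) (hR U hU)
      (by simpa using huY) (fun v hv hY => hU.notMem v hv (mem_insert_of_mem hY)) (by simp)
      hU.indep (by rw [sum_singleton]; omega)
  have hbonus : bonus q (insert x Y) (insert x R) ≤ bonus p Y W + 1 := by
    have h1 : #(insert x Y ∩ insert x R) ≤ #(Y ∩ R) + 1 := by
      rw [← insert_inter_distrib]
      exact card_insert_le _ _
    have h2 : bonus p Y R ≤ bonus p Y W := bonus_mono hs.symm.subset_left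
    unfold bonus at *
    omega
  rcases h with ⟨U, hU, v, hv, hl⟩ | ⟨U, P, hU, hP, hc, ht⟩
  · obtain ⟨hS, hc⟩ := hlight U hU
    exact .inl ⟨_, hS, v, mem_union_right _ hv, by rw [hload v (hR U hU hv)]; omega⟩
  obtain ⟨hS, hcS⟩ := hlight U hU
  -- The bonus unit lost when `x` ceases to be optional is repaid by the additional vertex `u`.
  have htight : (∃ A ∈ P, #A = 2) → ∃ v ∈ {u} ∪ U, G.load p W v ≤ #({u} ∪ U) + bonus p Y W := by
    intro h
    obtain ⟨v, hv, hl⟩ := ht h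
    exact ⟨v, mem_union_right _ hv, by rw [hload v (hR U hU hv)]; omega⟩
  by_cases hx : ∃ B ∈ P, x ∈ B
  · obtain ⟨B, hB, hxB⟩ := hx
    have hUpos : 1 ≤ #U := (card_pos.2 ⟨B, hB⟩).trans_le hc
    have hcard := card_union_le {A} P
    rw [card_singleton] at hcard
    have hPx : G.IsCover Y (insert x R) P := by
      refine ⟨hP.disjoint, hP.piece, hP.two_le, hP.subset, fun v hv hvY => ?_, hP.unique⟩
      by_cases hvx : v = x
      · exact ⟨B, hB, hvx ▸ hxB⟩
      · exact hP.cover v hv (by simp [hvY, hvx])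
    have hcov : (∀ B ∈ P, #A = 2 → #B = 2 → False) → G.IsCover Y W ({A} ∪ P) := fun hne => by
      refine hA.union hPx (disjoint_insert_right.2 ⟨hs.notMem_left, hs.disjoint⟩)
        (by rw [union_insert, ← hs.eq]) (fun v hv hvY => ?_) (by simpa using hne)
      rw [hs.eq, ← union_insert, mem_union] at hv
      exact hv.imp (⟨·, hvY⟩) (⟨·, hvY⟩)
    by_cases hAcard : #A = 2
    · have hl := hs.load_le_of_card (p := p) (Y := Y) hu hAcov
      by_cases hU2 : 2 ≤ #U
      · exact .inl ⟨_, hS, u, by simp, by omega⟩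
      have hPB : ∀ B' ∈ P, B' = B := fun B' hB' => card_le_one.1 (by omega) _ hB' _ hB
      -- If `A` and `B` are both edges, only one vertex of `R` is non-optional, so the pair `{u, w}`
      -- is already large.
      by_cases hBcard : #B = 2
      · left
        obtain ⟨hS', hc'⟩ := hs.isLight_pair (p := p) hu hw huY hwY
        have hl' := hs.symm.load_le_of_card (p := p) (Y := Y) (A := B.erase x) hw
          (fun v hv hvY => by
            have hvx : v ≠ x := fun h => hs.notMem_right (h ▸ hv)
            obtain ⟨B', hB', hvB'⟩ := hP.cover v (mem_insert_of_mem hv) (by simp [hvY, hvx])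
            exact mem_erase.2 ⟨hvx, hPB B' hB' ▸ hvB'⟩)
        rw [card_erase_of_mem hxB] at hl'
        exact ⟨_, hS', w, by simp, by omega⟩
      · refine .inr ⟨_, _, hS, hcov fun B' hB' _ h => hBcard (hPB B' hB' ▸ h), by omega,
          fun _ => ⟨u, by simp, by omega⟩⟩
    · refine .inr ⟨_, _, hS, hcov fun _ _ h => absurd h hAcard, by omega, fun h => htight ?_⟩
      obtain ⟨B', hB', h2⟩ := h
      rcases mem_union.1 hB' with h | h
      · rw [mem_singleton.1 h] at h2
        exact absurd h2 hAcard
      · exact ⟨B', h, h2⟩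
  · have hP' : G.IsCover Y R P := by
      refine ⟨hP.disjoint, hP.piece, hP.two_le, fun B hB a ha => ?_, fun v hv hvY => ?_,
        hP.unique⟩
      · exact (mem_insert.1 (hP.subset B hB ha)).resolve_left fun h => hx ⟨B, hB, h ▸ ha⟩
      · have hvx : v ≠ x := fun h => hs.notMem_right (h ▸ hv)
        exact hP.cover v (mem_insert_of_mem hv) (by simp [hvY, hvx])
    refine .inr ⟨_, _, hS, hs.isCover_insert hp hD hP', ?_, fun h =>
      htight (exists_card_eq_two_of_insert_cover hs hD h)⟩
    have := card_union_le {insert x D} P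
    rw [card_singleton] at this
    omega

/-- Neither side is covered by at most one piece. -/
lemma IsSplit.of_two_sides (hs : G.IsSplit W D R x) (hW : G.IsLinked W)
    (hp : G.IsPiece (insert x D)) (hD : 2 ≤ #D) (hD' : ∀ P, G.IsCover Y D P → 2 ≤ #P)
    (hR' : ∀ P, G.IsCover Y R P → 2 ≤ #P) (h₁ : G.HasLarge p Y D ∨ G.HasCover p Y D)
    (h₂ : G.HasLarge p Y R ∨ G.HasCover p Y R) : G.HasLarge p Y W ∨ G.HasCover p Y W := by
  have two : ∀ {C : Finset V}, (∀ P, G.IsCover Y C P → 2 ≤ #P) →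
      (G.HasLarge p Y C ∨ G.HasCover p Y C) →
      (G.HasLarge p Y C ∨ ∃ U, G.IsLight p Y C U ∧ 2 ≤ #U) := by
    rintro C hC (h | ⟨U, P, hU, hP, hc, -⟩)
    · exact .inl h
    · exact .inr ⟨U, hU, (hC P hP).trans hc⟩
  by_cases hL₁ : G.HasLarge p Y D
  · exact .inl (hs.hasLarge_of_hasLarge hL₁ (two hR' h₂))
  by_cases hL₂ : G.HasLarge p Y R
  · exact .inl (hs.symm.hasLarge_of_hasLarge hL₂ (two hD' h₁))
  obtain ⟨U₁, P₁, hU₁, hP₁, hc₁, -⟩ := h₁.resolve_left hL₁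
  obtain ⟨U₂, P₂, hU₂, hP₂, hc₂, ht₂⟩ := h₂.resolve_left hL₂
  have hU₁c := (hD' P₁ hP₁).trans hc₁
  refine (hs.exists_isLight_of_two_le hW hU₁ hU₂ (card_pos.1 (by omega))).imp_right ?_
  -- From `D` only `#U₁ ≥ 2` is used; its cover is replaced by the single piece `insert x D`. Since
  -- `U₂ ⊆ S` and `S` has a further vertex, the small load required for an edge in `P₂` survives the
  -- possible new neighbour `x`.
  rintro ⟨S, hS, hUS, hcS⟩
  refine ⟨S, _, hS, hs.isCover_insert hp hD hP₂, ?_, fun h => ?_⟩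
  · have := card_union_le {insert x D} P₂
    rw [card_singleton] at this
    omega
  · obtain ⟨v, hv, hl⟩ := ht₂ (exists_card_eq_two_of_insert_cover hs hD h)
    have := hs.symm.load_le_succ (p := p) (hU₂.subset hv)
    have := hs.bonus_add_le (p := p) (Y := Y)
    exact ⟨v, hUS hv, by omega⟩

/-- A single non-optional vertex cannot be a piece of a cover, but it has degree zero in `W` and is
therefore large by itself. -/
lemma hasLarge_or_hasCover_of_isPiece (hW : G.IsPiece W) :
    G.HasLarge p Y W ∨ G.HasCover p Y W := by
  by_cases hY : W ⊆ Y
  · exact .inr ⟨∅, ∅, isLight_empty hW.1, isCover_empty hY, by simp, by simp⟩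
  obtain ⟨u, hu, huY⟩ := not_subset.1 hY
  have hdeg := degIn_add_one_le (G := G) hu
  have hsum := single_le_sum (f := p) (fun _ _ => Nat.zero_le _) hu
  have hS := isLight_singleton (G := G) (p := p) hu huY
  by_cases h2 : 2 ≤ #W
  · refine .inr ⟨{u}, {W}, hS, isCover_singleton hW h2 subset_rfl fun v hv _ => hv, by simp, ?_⟩
    rintro ⟨A, hA, hA2⟩
    rw [mem_singleton] at hA
    subst hA
    refine ⟨u, by simp, ?_⟩
    rw [card_singleton]
    unfold load bonus
    omega
  · refine .inl ⟨{u}, hS, u, by simp, ?_⟩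
    rw [card_singleton]
    unfold load bonus
    omega

theorem hasLarge_or_hasCover (n : ℕ) : ∀ (W Y : Finset V) (p : V → ℕ), #W = n → W.Nonempty →
    G.HasLarge p Y W ∨ G.HasCover p Y W := by
  induction n using Nat.strong_induction_on with
  | _ n ih =>
  intro W Y p hn hne
  by_cases hlink : G.IsLinked W
  swap
  · unfold IsLinked at hlink
    push Not at hlink
    obtain ⟨C, hC, h1, h2, hadj⟩ := hlink
    have := card_sdiff_add_card_eq_card hC
    have := h1.card_pos
    have := h2.card_pos
    exact hasLarge_or_hasCover_of_disconnected disjoint_sdiff (union_sdiff_of_subset hC).symm hadj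
      (ih _ (by omega) C Y p rfl h1) (ih _ (by omega) _ Y p rfl h2)
  by_cases hpiece : G.IsPiece W
  · exact hasLarge_or_hasCover_of_isPiece hpiece
  obtain ⟨x, D, R, hs, hp⟩ := exists_isSplit_isPiece hne hlink hpiece
  have hcW := hs.card_eq
  have hcD := hs.nonempty_left.card_pos
  have hcR := hs.nonempty_right.card_pos
  have hcH := card_insert_of_notMem hs.notMem_right
  by_cases hDY : D ⊆ Y
  · exact hs.of_subset_optional hDY (ih _ (by omega) _ Y _ rfl (insert_nonempty _ _))
  obtain ⟨u, hu, huY⟩ := not_subset.1 hDY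
  by_cases hRY : R ⊆ Y
  · exact .inr (hs.hasCover_of_right_optional hp hu huY hRY)
  obtain ⟨w, hw, hwY⟩ := not_subset.1 hRY
  by_cases hD1 : #D = 1
  · exact .inl (hs.hasLarge_of_card_eq_one hD1 hu huY hw hwY)
  have two : ∀ {C : Finset V} {a : V}, a ∈ C → a ∉ Y → (¬ ∃ A, G.IsCover Y C {A}) →
      ∀ P, G.IsCover Y C P → 2 ≤ #P := fun ha haY hC P hP => by
    have h0 := (hP.nonempty_of_notMem ha haY).card_pos
    have h1 : #P ≠ 1 := fun h => by
      obtain ⟨A, rfl⟩ := card_eq_one.1 h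
      exact hC ⟨A, hP⟩
    omega
  by_cases hR1 : ∃ A, G.IsCover Y R {A}
  · obtain ⟨A, hA⟩ := hR1
    exact .inr (hs.hasCover_of_right_piece hp (by omega) hu huY hw hwY hA)
  by_cases hDA : ∃ A, G.IsCover Y D {A}
  · obtain ⟨A, hA⟩ := hDA
    exact hs.of_left_piece hp hu huY hw hwY hA
      (ih _ (by omega) _ _ _ rfl (insert_nonempty _ _))
  · exact hs.of_two_sides hlink hp (by omega) (two hu huY hDA) (two hw hwY hR1)
      (ih _ (by omega) D Y p rfl hs.nonempty_left) (ih _ (by omega) R Y p rfl hs.nonempty_right)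

end

/-! ### Translation to induced subgraphs and to the invariants of the theorem -/

lemma IsLinked.connected {V : Type*} [DecidableEq V] {G : SimpleGraph V} {S : Finset V}
    (h : G.IsLinked S) (hne : S.Nonempty) : (G.induce (S : Set V)).Connected := by
  classical
  have : Nonempty (S : Set V) := hne.to_set.to_subtype
  refine ⟨fun a b => ?_⟩
  by_contra hab
  let C : Finset V := S.filter fun v => ∃ hv : v ∈ (S : Set V),
    (G.induce (S : Set V)).Reachable a ⟨v, hv⟩
  obtain ⟨v, hv, w, hw, hvw⟩ := h C (filter_subset _ _)
    ⟨a, mem_filter.2 ⟨a.2, a.2, .rfl⟩⟩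
    ⟨b, mem_sdiff.2 ⟨b.2, fun hb => hab (mem_filter.1 hb).2.2⟩⟩
  obtain ⟨-, hvS, hav⟩ := mem_filter.1 hv
  obtain ⟨hwS, hwC⟩ := mem_sdiff.1 hw
  exact hwC (mem_filter.2 ⟨hwS, hwS, hav.trans (Adj.reachable (by simpa using hvw))⟩)

lemma Connected.induce_compl {V : Type*} [DecidableEq V] {G : SimpleGraph V} {A B : Finset V}
    (S : Finset (A : Set V)) (hB : B = A \ S.map (Function.Embedding.subtype _))
    (h : (G.induce (B : Set V)).Connected) :
    ((G.induce (A : Set V)).induce ((S : Set (A : Set V))ᶜ)).Connected := by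
  have hmem : ∀ v, v ∈ B ↔ ∃ hv : v ∈ (A : Set V), (⟨v, hv⟩ : (A : Set V)) ∉ S := by
    intro v
    simp only [hB, mem_sdiff, mem_map, not_exists, not_and, Function.Embedding.subtype_apply]
    exact ⟨fun h => ⟨h.1, fun hv => h.2 _ hv rfl⟩, fun ⟨hv, hS⟩ => ⟨hv, by
      rintro a ha rfl
      exact hS ha⟩⟩
  let e : (G.induce (B : Set V)) ≃g ((G.induce (A : Set V)).induce ((S : Set (A : Set V))ᶜ)) :=
    { toFun := fun v => ⟨⟨v.1, ((hmem v.1).1 v.2).1⟩, ((hmem v.1).1 v.2).2⟩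
      invFun := fun v => ⟨v.1.1, (hmem v.1.1).2 ⟨v.1.2, v.2⟩⟩
      left_inv := fun _ => rfl
      right_inv := fun _ => rfl
      map_rel_iff' := Iff.rfl }
  exact e.connected_iff.1 h

lemma IsPiece.isKConnected {V : Type*} [Fintype V] [DecidableEq V] {G : SimpleGraph V}
    {A : Finset V} (h : G.IsPiece A) (h3 : 3 ≤ #A) :
    (G.induce (A : Set V)).IsKConnected 2 := by
  refine ⟨?_, fun S hS => ?_⟩
  · simp only [coe_sort_coe, Nat.card_eq_fintype_card, Fintype.card_coe]
    omega
  rcases Nat.lt_succ_iff_lt_or_eq.1 hS with h0 | h1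
  · obtain rfl : S = ∅ := card_eq_zero.1 (by omega)
    exact Connected.induce_compl _ (by simp) (h.2.1.connected h.1)
  · obtain ⟨v, rfl⟩ := card_eq_one.1 h1
    refine Connected.induce_compl (B := A.erase v) _ ?_
      ((h.2.2 v v.2).connected (card_pos.1 ?_))
    · ext w
      simp [and_comm]
    · have := pred_card_le_card_erase (s := A) (a := (v : V))
      omega

lemma IsPiece.nonempty_iso {V : Type*} [Fintype V] [DecidableEq V] {G : SimpleGraph V}
    {A : Finset V} (h : G.IsPiece A) (h2 : #A = 2) :
    Nonempty (G.induce (A : Set V) ≃g completeGraph (Fin 2)) := by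
  obtain ⟨a, b, hab, rfl⟩ := card_eq_two.1 h2
  obtain ⟨c, hc, d, hd, hadj⟩ := h.2.1 {a} (by simp) (by simp)
    ⟨b, by simp [hab.symm]⟩
  obtain rfl : c = a := by simpa using hc
  obtain rfl : d = b := by
    simp only [mem_sdiff, mem_insert, mem_singleton] at hd
    tauto
  have htop : G.induce (({c, d} : Finset V) : Set V) = ⊤ := by
    ext ⟨v, hv⟩ ⟨w, hw⟩
    simp only [coe_insert, coe_singleton, Set.mem_insert_iff, Set.mem_singleton_iff] at hv hw
    rcases hv with rfl | rfl <;> rcases hw with rfl | rfl <;>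
      simp [hadj, hadj.symm, hab, hab.symm]
  rw [htop]
  exact ⟨Iso.completeGraph (Fintype.equivFinOfCardEq (by simpa using h2))⟩

section

variable {V : Type*} [Fintype V] [DecidableEq V] {G : SimpleGraph V} [DecidableRel G.Adj]

lemma load_zero_univ (u : V) : G.load 0 univ u = G.degree u := by
  simp [load, degIn, ← card_neighborFinset_eq_degree, neighborFinset_eq_filter]

lemma IsLight.isLightIndepSet {U : Finset V} (hU : G.IsLight 0 ∅ univ U) :
    G.IsLightIndepSet U := by
  refine ⟨fun u hu v hv _ => hU.indep u hu v hv, ?_⟩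
  simpa [load_zero_univ, degreeWeight] using hU.weight

lemma not_hasLarge (hG : (Fintype.card V : ℕ∞) ≤ G.sigmaStar) :
    ¬ G.HasLarge 0 ∅ (univ : Finset V) := by
  rintro ⟨U, hU, u, hu, hl⟩
  have hlight := hU.isLightIndepSet
  rw [load_zero_univ] at hl
  have hmin : G.minDegreeOn U + 1 ≤ (#U : ℕ∞) := by
    calc G.minDegreeOn U + 1 ≤ (G.degree u : ℕ∞) + 1 := by
          gcongr
          exact inf_le hu
      _ ≤ (#U : ℕ∞) := by
          have : G.degree u + 1 ≤ #U := by simpa [bonus] using hl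
          exact_mod_cast this
  have hle : G.sigmaStar ≤ (G.degreeWeight U : ℕ∞) := iInf₂_le U ⟨hlight.1, hmin⟩
  have h1 : Fintype.card V ≤ G.degreeWeight U := by exact_mod_cast hG.trans hle
  have h2 := hlight.2
  omega

lemma IsLightIndepSet.card_le_alphaStar {U : Finset V} (hU : G.IsLightIndepSet U) :
    #U ≤ G.alphaStar :=
  le_csSup ⟨Fintype.card V, by rintro m ⟨I, -, rfl⟩; exact card_le_univ I⟩ ⟨U, hU, rfl⟩

lemma IsCover.exists_isAlmostTwoProper [Nonempty V] {P : Finset (Finset V)}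
    (hP : G.IsCover ∅ univ P) :
    ∃ Q : Finpartition (univ : Finset V), G.IsAlmostTwoProper Q ∧ Q.parts = P := by
  let Q : Finpartition (univ : Finset V) :=
    { parts := P
      supIndep := supIndep_iff_pairwiseDisjoint.2 hP.disjoint
      sup_parts := by
        refine eq_univ_iff_forall.2 fun v => ?_
        obtain ⟨A, hA, hv⟩ := hP.cover v (mem_univ v) (by simp)
        exact mem_sup.2 ⟨A, hA, hv⟩
      bot_notMem := fun h => by simpa using hP.two_le _ h }
  refine ⟨Q, ?_, rfl⟩
  have hk : ∀ A ∈ P, #A ≠ 2 → (G.induce (A : Set V)).IsKConnected 2 := fun A hA h =>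
    (hP.piece A hA).isKConnected (by have := hP.two_le A hA; omega)
  by_cases h : ∃ A ∈ P, #A = 2
  · obtain ⟨A, hA, h2⟩ := h
    exact ⟨A, hA, .inr ((hP.piece A hA).nonempty_iso h2), fun B hB hBA =>
      hk B hB fun hB2 => hBA (hP.unique B hB A hA hB2 h2)⟩
  · push Not at h
    obtain ⟨A, hA, -⟩ := hP.cover (Classical.arbitrary V) (mem_univ _) (by simp)
    exact ⟨A, hA, .inl (hk A hA (h A hA)), fun B hB _ => hk B hB (h B hB)⟩

end

end SimpleGraph

theorem corollary1p13 {V : Type*} [Fintype V] [DecidableEq V] [Nonempty V]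
    (G : SimpleGraph V) [DecidableRel G.Adj]
    (hG : (Fintype.card V : ℕ∞) ≤ G.sigmaStar) :
    ∃ P : Finpartition (Finset.univ : Finset V),
      G.IsAlmostTwoProper P ∧ P.parts.card ≤ G.alphaStar := by
  obtain ⟨U, P, hU, hP, hc, -⟩ :=
    (SimpleGraph.hasLarge_or_hasCover _ Finset.univ ∅ 0 rfl Finset.univ_nonempty).resolve_left
      (SimpleGraph.not_hasLarge hG)
  obtain ⟨Q, hQ, rfl⟩ := hP.exists_isAlmostTwoProper
  exact ⟨Q, hQ, hc.trans hU.isLightIndepSet.card_le_alphaStar⟩
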